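/- Let $(\Omega,\mathcal F,\mathbb P)$ be an atomless probability space, i.e. every event of positive probability contains an event of strictly smaller positive probability. An event $A\in\mathcal F$ is a tail event for a random variable $X$ if, outside a null set, $X(\omega)\ge X(\omega')$ for all $\omega\in A$ and $\omega'\in A^c$. For $p\in[0,1]$, a random vector $(X_1,\dots,X_d)$ is $p$-concentrated if there is an event $A$ with $\mathbb P(A)=1-p$ that is a tail event for every $X_i$; for $K\subseteq[0,1]$ it is $K$-concentrated if it is $p$-concentrated for each $p\in K$. A functional $\rho:L^\infty(\Omega,\mathcal F,\mathbb P)\to\mathbb R$ is $K$-additive if $\rho\bigl(\sum_{i=1}^d X_i\bigr)=\sum_{i=1}^d\rho(X_i)$ for every $d$ and every $K$-concentrated random vector $(X_1,\dots,X_d)$ with all $X_i\in L^\infty$. For a function $h:[0,1]\to\mathbb R$ of bounded variation with $h(0)=0$, let $$I_h(X)=\int_{-\infty}^0\bigl[h(\mathbb P(X>x))-h(1)\bigr]\,dx+\int_0^\infty h(\mathbb P(X>x))\,dx,\qquad X\in L^\infty .$$ **Theorem.** Let $K$ be a closed subset of $[0,1]$, and decompose the complement $[0,1]\setminus K$ into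 its connected components $B_i$, which are pairwise disjoint intervals, open in $[0,1]$. Let $h:[0,1]\to\mathbb R$ be of bounded variation with $h(0)=0$. Then $I_h$ is $K$-additive if and only if, for each $i$, $h$ is linear on $\mathrm{cl}(1-B_i)$, i.e. there are $m_i,c_i\in\mathbb R$ with $h(t)=m_it+c_i$ for all $t\in\mathrm{cl}(1-B_i)$, where $1-B_i=\{1-x:x\in B_i\}$ and $\mathrm{cl}$ denotes closure. -/

import Mathlib

open Set MeasureTheory

/-- The measure `P` is atomless: every event of positive probability contains an event of
strictly smaller positive probability. (Mathlib's `NoAtoms` only says that points are null.) -/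
def IsAtomless {Ω : Type*} [MeasurableSpace Ω] (P : Measure Ω) : Prop :=
  ∀ A : Set Ω, MeasurableSet A → 0 < P A →
    ∃ B : Set Ω, MeasurableSet B ∧ B ⊆ A ∧ 0 < P B ∧ P B < P A

/-- The event `A` is a tail event for `X`: almost surely, `X ω' ≤ X ω` for all `ω ∈ A` and
`ω' ∉ A`, i.e. after removal of one null set from `Ω`. -/
def IsTailEvent {Ω : Type*} [MeasurableSpace Ω] (P : Measure Ω) (X : Ω → ℝ) (A : Set Ω) : Prop :=
  MeasurableSet A ∧
    ∃ S ∈ ae P, ∀ ω ∈ S, ∀ ω' ∈ S, ω ∈ A → ω' ∉ A → X ω' ≤ X ω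

/-- The random vector `X` is `p`-concentrated: its components share a common tail event of
probability `1 - p`. -/
def IsPConcentrated {Ω : Type*} [MeasurableSpace Ω] (P : Measure Ω) {d : ℕ}
    (X : Fin d → Ω → ℝ) (p : ℝ) : Prop :=
  ∃ A : Set Ω, P.real A = 1 - p ∧ ∀ i, IsTailEvent P (X i) A

/-- The random vector `X` is `K`-concentrated: it is `p`-concentrated for each `p ∈ K`. -/
def IsKConcentrated {Ω : Type*} [MeasurableSpace Ω] (P : Measure Ω) {d : ℕ}
    (X : Fin d → Ω → ℝ) (K : Set ℝ) : Prop :=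
  ∀ p ∈ K, IsPConcentrated P X p

/-- The functional `ρ` on `L^∞` is `K`-additive: it is additive on the components of every
`K`-concentrated random vector, of any dimension, with components in `L^∞`. -/
def IsKAdditive {Ω : Type*} [MeasurableSpace Ω] (P : Measure Ω)
    (ρ : (Ω → ℝ) → ℝ) (K : Set ℝ) : Prop :=
  ∀ (d : ℕ) (X : Fin d → Ω → ℝ), (∀ i, MemLp (X i) ⊤ P) → IsKConcentrated P X K →
    ρ (fun ω => ∑ i, X i ω) = ∑ i, ρ (X i)

/-- Distortion functions: functions of bounded variation on `[0,1]` that vanish at `0`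
(values outside `[0,1]` play no role). -/
def IsDistortion (h : ℝ → ℝ) : Prop :=
  BoundedVariationOn h (Icc 0 1) ∧ h 0 = 0

/-- The distortion riskmetric `I_h`. Both integrands are bounded, measurable and of bounded
support when `h` is a distortion function and `X` is in `L^∞`. -/
noncomputable def distortionRiskmetric {Ω : Type*} [MeasurableSpace Ω] (P : Measure Ω)
    (h : ℝ → ℝ) (X : Ω → ℝ) : ℝ :=
  (∫ x in Iic (0 : ℝ), (h (P.real {ω | x < X ω}) - h 1)) +
    ∫ x in Ioi (0 : ℝ), h (P.real {ω | x < X ω})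

/-- The intervals into which the complement of `K` in `[0,1]` decomposes, i.e. its connected
components. For closed `K` these are intervals open in `[0,1]`, and they are pairwise disjoint. -/
def gaps (K : Set ℝ) : Set (Set ℝ) :=
  {B | ∃ x ∈ Icc (0 : ℝ) 1 \ K, B = connectedComponentIn (Icc (0 : ℝ) 1 \ K) x}

/-- `h` is linear on `S`, in the sense of having constant slope: it agrees there with
`t ↦ m * t + c`. -/
def IsLinearOn (h : ℝ → ℝ) (S : Set ℝ) : Prop :=
  ∃ m c : ℝ, ∀ t ∈ S, h t = m * t + c

/-!
Both directions rest on the set function `E ↦ h (P E)`.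

*Additivity implies linearity.* Let `[a, b]` be the closure of `1 - B` for a gap `B`. By Sierpiński's
theorem (`IsAtomless.exists_subset_measureReal_eq`) there are disjoint events `A`, `C`, `D` of
probabilities `a`, `c`, `d` inside an event of probability `b`. The indicators of `A ∪ C` and `A ∪ D`
are constant on `A` and on the complement of the large event, hence concentrated at every level of
`K`, and additivity of the riskmetric on them reads `h (a + c + d) + h a = h (a + c) + h (a + d)`
(`IsKAdditive.distortion_add`). So `h (a + ·) - h a` is additive on `[0, b - a]`; being bounded, it
is linear (`eq_mul_of_additive_of_bounded`).

*Linearity implies additivity.* Fix tail events `A p`, `p ∈ K`. The level sets of a random variable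
having all of them as tail events are comparable with every `A p`, and the events with this
property form a lattice (`nestedEvents`). On it `h ∘ P` is modular (`distortion_modular`): two such
events are either separated by some `A p`, hence nested, or their probabilities lie in one gap, on
the closure of which `h` is affine. A modular set function has additive level sums
(`sum_level_add`), which is the desired additivity for integer-valued variables. For bounded `X` and
`Y`, replacing them by integer parts changes the riskmetrics by at most a constant that depends on
`h` alone (`exists_abs_distortionRiskmetric_sub_sum_le`, by the Jordan decomposition of `h`). So the
additivity defect of `(X, Y)` is bounded uniformly; applied to `(n X, n Y)`, whose defect is `n` times
as large, this shows that it vanishes (`distortionRiskmetric_add`). No continuity of `h` is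
involved.
-/

/-! ### Events of prescribed probability in an atomless space -/

lemma IsAtomless.exists_subset_small {Ω : Type*} [MeasurableSpace Ω] {P : Measure Ω}
    [IsFiniteMeasure P] (hP : IsAtomless P) {A : Set Ω} (hA : MeasurableSet A)
    (h0 : 0 < P.real A) {ε : ℝ} (hε : 0 < ε) :
    ∃ B ⊆ A, MeasurableSet B ∧ 0 < P.real B ∧ P.real B ≤ ε := by
  have half : ∀ n : ℕ, ∃ B ⊆ A, MeasurableSet B ∧ 0 < P.real B ∧
      P.real B ≤ P.real A * (1 / 2) ^ n := by
    intro n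
    induction n with
    | zero => exact ⟨A, subset_rfl, hA, h0, by simp⟩
    | succ n ih =>
      obtain ⟨B, hBA, hB, hB0, hBn⟩ := ih
      obtain ⟨C, hC, hCB, hC0, hClt⟩ := hP B hB (ENNReal.toReal_pos_iff.1 hB0).1
      have hC0' : 0 < P.real C := ENNReal.toReal_pos hC0.ne' (measure_ne_top _ _)
      have hlt : P.real C < P.real B :=
        (ENNReal.toReal_lt_toReal (measure_ne_top _ _) (measure_ne_top _ _)).2 hClt
      have hd : P.real (B \ C) = P.real B - P.real C := measureReal_sdiff hCB hC
      rw [pow_succ]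
      rcases le_total (P.real C) (P.real (B \ C)) with h | h
      · exact ⟨C, hCB.trans hBA, hC, hC0', by linarith⟩
      · exact ⟨B \ C, sdiff_subset.trans hBA, hB.diff hC, by linarith, by linarith⟩
  obtain ⟨n, hn⟩ := exists_pow_lt_of_lt_one (div_pos hε h0) (by norm_num : (1 / 2 : ℝ) < 1)
  obtain ⟨B, hBA, hB, hB0, hBn⟩ := half n
  refine ⟨B, hBA, hB, hB0, hBn.trans ?_⟩
  rw [lt_div_iff₀ h0] at hn
  linarith

/-- Sierpiński's theorem: an atomless finite measure takes all intermediate values. A chain of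
subsets of measure at most `c` is built so that each step realizes at least half of the largest
possible gain; its union has measure `c`, as otherwise a small set could still be added. -/
theorem IsAtomless.exists_subset_measureReal_eq {Ω : Type*} [MeasurableSpace Ω] {P : Measure Ω}
    [IsFiniteMeasure P] (hP : IsAtomless P) {A : Set Ω} (hA : MeasurableSet A) {c : ℝ}
    (h0 : 0 ≤ c) (hc : c ≤ P.real A) :
    ∃ B ⊆ A, MeasurableSet B ∧ P.real B = c := by
  let T := {B : Set Ω // MeasurableSet B ∧ B ⊆ A ∧ P.real B ≤ c}
  have step : ∀ B : T, ∃ B' : T, B.1 ⊆ B'.1 ∧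
      ∀ D : T, B.1 ⊆ D.1 → P.real D.1 + P.real B.1 ≤ 2 * P.real B'.1 := by
    intro B
    let S : Set ℝ := {x | ∃ D : T, B.1 ⊆ D.1 ∧ x = P.real D.1}
    have hbdd : BddAbove S := ⟨c, by rintro x ⟨D, -, rfl⟩; exact D.2.2.2⟩
    have hmem : P.real B.1 ∈ S := ⟨B, subset_rfl, rfl⟩
    rcases (le_csSup hbdd hmem).eq_or_lt with h | h
    · refine ⟨B, subset_rfl, fun D hD => ?_⟩
      have := le_csSup hbdd (show P.real D.1 ∈ S from ⟨D, hD, rfl⟩)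
      linarith
    · obtain ⟨x, ⟨B', hB', rfl⟩, hx⟩ := exists_lt_of_lt_csSup ⟨_, hmem⟩
        (show (sSup S + P.real B.1) / 2 < sSup S by linarith)
      refine ⟨B', hB', fun D hD => ?_⟩
      have := le_csSup hbdd (show P.real D.1 ∈ S from ⟨D, hD, rfl⟩)
      linarith
  choose next hsub hgain using step
  let s : ℕ → T := fun n => next^[n] ⟨∅, MeasurableSet.empty, empty_subset _, by simpa using h0⟩
  have hs : ∀ n, s (n + 1) = next (s n) := fun n => Function.iterate_succ_apply' next n _
  have hmono : Monotone fun n => (s n).1 :=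
    monotone_nat_of_le_succ fun n => by rw [hs]; exact hsub _
  have hBm : MeasurableSet (⋃ n, (s n).1) := MeasurableSet.iUnion fun n => (s n).2.1
  have hBA : (⋃ n, (s n).1) ⊆ A := iUnion_subset fun n => (s n).2.2.1
  have hlim : Filter.Tendsto (fun n => P.real (s n).1) Filter.atTop
      (nhds (P.real (⋃ n, (s n).1))) :=
    (ENNReal.tendsto_toReal (measure_ne_top _ _)).comp (tendsto_measure_iUnion_atTop hmono)
  refine ⟨_, hBA, hBm, le_antisymm (le_of_tendsto' hlim fun n => (s n).2.2.2) ?_⟩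
  by_contra! hlt
  set B := ⋃ n, (s n).1
  have hd : P.real (A \ B) = P.real A - P.real B := measureReal_sdiff hBA hBm
  obtain ⟨D, hDA, hD, hD0, hDc⟩ := hP.exists_subset_small (hA.diff hBm)
    (by linarith : 0 < P.real (A \ B)) (sub_pos.2 hlt)
  have hdisj : Disjoint B D := disjoint_sdiff_right.mono_right hDA
  have hu : P.real (B ∪ D) = P.real B + P.real D := measureReal_union hdisj hD
  have hge : ∀ n, P.real (B ∪ D) + P.real (s n).1 ≤ 2 * P.real (s (n + 1)).1 := by
    intro n
    rw [hs]
    exact hgain (s n) ⟨B ∪ D, hBm.union hD, union_subset hBA (hDA.trans sdiff_subset),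
      by linarith⟩ ((subset_iUnion (fun n => (s n).1) n).trans subset_union_left)
  have := le_of_tendsto_of_tendsto' (hlim.const_add (P.real (B ∪ D)))
    (((Filter.tendsto_add_atTop_iff_nat 1).2 hlim).const_mul 2) hge
  linarith

/-! ### The distortion riskmetric -/

lemma antitone_comp_measureReal_lt {Ω : Type*} [MeasurableSpace Ω] {P : Measure Ω}
    [IsProbabilityMeasure P] {p : ℝ → ℝ} (hp : MonotoneOn p (Icc 0 1)) (X : Ω → ℝ) :
    Antitone fun x : ℝ => p (P.real {ω | x < X ω}) := fun x y hxy =>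
  hp ⟨measureReal_nonneg, measureReal_le_one⟩ ⟨measureReal_nonneg, measureReal_le_one⟩
    (measureReal_mono fun _ hω => lt_of_le_of_lt hxy hω)

/-- Jordan decomposition of a function of bounded variation on `[0,1]`. -/
lemma BoundedVariationOn.exists_monotoneOn_Icc {h : ℝ → ℝ}
    (hh : BoundedVariationOn h (Icc 0 1)) :
    ∃ p q : ℝ → ℝ, MonotoneOn p (Icc 0 1) ∧ MonotoneOn q (Icc 0 1) ∧ ∀ x, h x = p x - q x := by
  obtain ⟨p, q, hp, hq, hpq⟩ :=
    hh.locallyBoundedVariationOn.exists_monotoneOn_sub_monotoneOn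
  exact ⟨p, q, hp, hq, fun x => by rw [hpq]; rfl⟩

lemma intervalIntegrable_comp_measureReal_lt {Ω : Type*} [MeasurableSpace Ω] {P : Measure Ω}
    [IsProbabilityMeasure P] {h : ℝ → ℝ} (hh : BoundedVariationOn h (Icc 0 1)) (X : Ω → ℝ)
    (a b : ℝ) :
    IntervalIntegrable (fun x : ℝ => h (P.real {ω | x < X ω})) volume a b := by
  obtain ⟨p, q, hp, hq, hpq⟩ := hh.exists_monotoneOn_Icc
  simp only [hpq]
  exact (antitone_comp_measureReal_lt hp X).intervalIntegrable.sub
    (antitone_comp_measureReal_lt hq X).intervalIntegrable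

/-- On random variables with values in `[a, b]`, the two improper integrals defining the
riskmetric combine into one proper integral. -/
lemma distortionRiskmetric_eq_intervalIntegral {Ω : Type*} [MeasurableSpace Ω] {P : Measure Ω}
    [IsProbabilityMeasure P] {h : ℝ → ℝ} (hh : IsDistortion h) {X : Ω → ℝ} {a b : ℝ}
    (ha : a ≤ 0) (hb : 0 ≤ b) (hX : ∀ᵐ ω ∂P, a ≤ X ω ∧ X ω ≤ b) :
    distortionRiskmetric P h X = (∫ x in a..b, h (P.real {ω | x < X ω})) + a * h 1 := by
  have h1 : ∫ x in Iic (0 : ℝ), (h (P.real {ω | x < X ω}) - h 1)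
      = ∫ x in a..0, (h (P.real {ω | x < X ω}) - h 1) := by
    rw [intervalIntegral.integral_of_le ha, ← integral_Icc_eq_integral_Ioc]
    refine (setIntegral_eq_of_subset_of_forall_sdiff_eq_zero measurableSet_Iic
      Icc_subset_Iic_self fun x hx => ?_)
    have hxa : x < a := by
      by_contra! hax
      exact hx.2 ⟨hax, hx.1⟩
    have : P.real {ω | x < X ω} = 1 := by
      rw [measureReal_congr (t := univ), probReal_univ]
      rw [ae_eq_univ, ← mem_ae_iff]
      filter_upwards [hX] with ω hω using hxa.trans_le hω.1
    rw [this, sub_self]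
  have h2 : ∫ x in Ioi (0 : ℝ), h (P.real {ω | x < X ω})
      = ∫ x in 0..b, h (P.real {ω | x < X ω}) := by
    rw [intervalIntegral.integral_of_le hb]
    refine (setIntegral_eq_of_subset_of_forall_sdiff_eq_zero measurableSet_Ioi
      Ioc_subset_Ioi_self fun x hx => ?_)
    have hbx : b < x := by
      by_contra! hxb
      exact hx.2 ⟨hx.1, hxb⟩
    have : P.real {ω | x < X ω} = 0 := by
      rw [measureReal_eq_zero_iff, ← compl_compl {ω | x < X ω}, ← mem_ae_iff]
      filter_upwards [hX] with ω hω
      exact not_lt.2 (hω.2.trans hbx.le)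
    rw [this, hh.2]
  have hi := intervalIntegrable_comp_measureReal_lt (P := P) hh.1 X
  rw [distortionRiskmetric, h1, h2, intervalIntegral.integral_sub (hi _ _) (by simp),
    ← intervalIntegral.integral_add_adjacent_intervals (hi a 0) (hi 0 b)]
  simp
  ring

lemma distortionRiskmetric_zero {Ω : Type*} [MeasurableSpace Ω] {P : Measure Ω}
    [IsProbabilityMeasure P] {h : ℝ → ℝ} (hh : IsDistortion h) :
    distortionRiskmetric P h (fun _ => 0) = 0 := by
  rw [distortionRiskmetric_eq_intervalIntegral hh le_rfl le_rfl (by simp)]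
  simp

/-- Positive homogeneity. -/
lemma distortionRiskmetric_const_mul {Ω : Type*} [MeasurableSpace Ω] (P : Measure Ω)
    (h : ℝ → ℝ) (X : Ω → ℝ) {c : ℝ} (hc : 0 < c) :
    distortionRiskmetric P h (fun ω => c * X ω) = c * distortionRiskmetric P h X := by
  have key : ∀ x : ℝ, {ω | c * x < c * X ω} = {ω | x < X ω} := fun x => by
    simp only [mul_lt_mul_iff_right₀ hc]
  have h1 := integral_comp_mul_left_Ioi' (fun x => h (P.real {ω | x < c * X ω})) 0 hc
  have h2 := integral_comp_mul_left_Ioi' (fun x => h (P.real {ω | -x < c * X ω}) - h 1) 0 hc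
  have h3 := integral_comp_neg_Ioi (0 : ℝ) (fun x => h (P.real {ω | x < c * X ω}) - h 1)
  have h4 := integral_comp_neg_Ioi (0 : ℝ) (fun x => h (P.real {ω | x < X ω}) - h 1)
  simp only [← mul_neg, key, mul_zero, neg_zero, smul_eq_mul] at h1 h2 h3 h4
  rw [distortionRiskmetric, distortionRiskmetric, ← h1, ← h3, ← h2, h4]
  ring

/-- The level sum `∑ h (P (W > k))` of an integer-valued `W` approximates the layer integral of
any `Z` within distance `2` above `W`, with an error that does not depend on the range. The distance `2` allows for
a sum of two integer parts. -/
lemma abs_integral_sub_sum_le_of_monotoneOn {Ω : Type*} [MeasurableSpace Ω] {P : Measure Ω}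
    [IsProbabilityMeasure P] {p : ℝ → ℝ} (hp : MonotoneOn p (Icc 0 1)) {Z : Ω → ℝ} {W : Ω → ℕ}
    (hWZ : ∀ᵐ ω ∂P, W ω ≤ Z ω ∧ Z ω ≤ W ω + 2) (N : ℕ) :
    |(∫ x in (0 : ℝ)..N, p (P.real {ω | x < Z ω})) -
      ∑ k ∈ Finset.range N, p (P.real {ω | k < W ω})| ≤ 2 * (p 1 - p 0) := by
  set g : ℝ → ℝ := fun x => p (P.real {ω | x < Z ω}) with hg
  have hanti : Antitone g := antitone_comp_measureReal_lt hp Z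
  have hmem : ∀ E : Set Ω, P.real E ∈ Icc (0 : ℝ) 1 := fun E =>
    ⟨measureReal_nonneg, measureReal_le_one⟩
  have hg1 : ∀ x, g x ≤ p 1 := fun x => hp (hmem _) (by simp) (hmem _).2
  have hg0 : ∀ x, p 0 ≤ g x := fun x => hp (by simp) (hmem _) (hmem _).1
  have hae : ∀ {E F : Set Ω}, E ≤ᵐ[P] F → P.real E ≤ P.real F := fun hEF =>
    ENNReal.toReal_mono (measure_ne_top _ _) (measure_mono_ae hEF)
  have hlow : ∀ k : ℕ, p (P.real {ω | k < W ω}) ≤ g k := fun k => by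
    refine hp (hmem _) (hmem _) (hae ?_)
    filter_upwards [hWZ] with ω hω hk
    exact lt_of_lt_of_le (Nat.cast_lt.2 hk) hω.1
  have hupp : ∀ k : ℕ, g ((k + 2 : ℕ) : ℝ) ≤ p (P.real {ω | k < W ω}) := fun k => by
    refine hp (hmem _) (hmem _) (hae ?_)
    filter_upwards [hWZ] with ω hω hk
    have hk' : ((k + 2 : ℕ) : ℝ) < Z ω := hk
    have : (k : ℝ) < W ω := by push_cast at hk'; linarith [hω.2]
    exact Nat.cast_lt.1 this
  have i1 : ∑ k ∈ Finset.range N, g ((k + 1 : ℕ) : ℝ) ≤ ∫ x in (0 : ℝ)..N, g x := by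
    simpa using (hanti.antitoneOn (Icc 0 (0 + (N : ℝ)))).sum_le_integral
  have i2 : (∫ x in (0 : ℝ)..N, g x) ≤ ∑ k ∈ Finset.range N, g k := by
    simpa using (hanti.antitoneOn (Icc 0 (0 + (N : ℝ)))).integral_le_sum
  have t1 := Finset.sum_range_sub' (fun k : ℕ => g k) N
  have t2 := Finset.sum_range_sub' (fun k : ℕ => g ((k + 1 : ℕ) : ℝ)) N
  rw [Finset.sum_sub_distrib] at t1 t2
  have s1 := Finset.sum_le_sum fun k (_ : k ∈ Finset.range N) => hlow k
  have s2 := Finset.sum_le_sum fun k (_ : k ∈ Finset.range N) => hupp k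
  have b1 := hg1 ((0 : ℕ) : ℝ)
  have b2 := hg0 (N : ℝ)
  have b3 := hg1 ((0 + 1 : ℕ) : ℝ)
  have b4 := hg0 ((N + 1 : ℕ) : ℝ)
  simp only [add_assoc, Nat.reduceAdd] at t2
  rw [abs_le]
  constructor <;> linarith

/-- The riskmetric is within a uniform distance of a level sum of an integer-valued
approximation. Combined with homogeneity, this makes additivity on integer-valued variables
sufficient. -/
lemma exists_abs_distortionRiskmetric_sub_sum_le {Ω : Type*} [MeasurableSpace Ω] {P : Measure Ω}
    [IsProbabilityMeasure P] {h : ℝ → ℝ} (hh : IsDistortion h) :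
    ∃ C : ℝ, ∀ (N : ℕ) (X : Ω → ℝ) (W : Ω → ℕ), (∀ᵐ ω ∂P, |X ω| ≤ N) →
      (∀ᵐ ω ∂P, W ω ≤ X ω + N ∧ X ω + N ≤ W ω + 2) →
      |distortionRiskmetric P h X -
        (∑ k ∈ Finset.range (2 * N), h (P.real {ω | k < W ω}) - N * h 1)| ≤ C := by
  obtain ⟨p, q, hp, hq, hpq⟩ := hh.1.exists_monotoneOn_Icc
  refine ⟨2 * (p 1 - p 0) + 2 * (q 1 - q 0), fun N X W hX hW => ?_⟩
  have hshift : (∫ x in (-N : ℝ)..N, h (P.real {ω | x < X ω}))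
      = ∫ x in (0 : ℝ)..(2 * N : ℕ), h (P.real {ω | x < X ω + N}) := by
    have := intervalIntegral.integral_comp_add_right (a := -(N : ℝ)) (b := N)
      (fun x => h (P.real {ω | x < X ω + N})) (N : ℝ)
    simp only [add_lt_add_iff_right] at this
    rw [this]
    congr 1 <;> push_cast <;> ring
  have hsplit : (∫ x in (0 : ℝ)..(2 * N : ℕ), h (P.real {ω | x < X ω + N}))
      = (∫ x in (0 : ℝ)..(2 * N : ℕ), p (P.real {ω | x < X ω + N}))
        - ∫ x in (0 : ℝ)..(2 * N : ℕ), q (P.real {ω | x < X ω + N}) := by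
    simp only [hpq]
    exact intervalIntegral.integral_sub (antitone_comp_measureReal_lt hp _).intervalIntegrable
      (antitone_comp_measureReal_lt hq _).intervalIntegrable
  have hsum : ∑ k ∈ Finset.range (2 * N), h (P.real {ω | k < W ω})
      = ∑ k ∈ Finset.range (2 * N), p (P.real {ω | k < W ω})
        - ∑ k ∈ Finset.range (2 * N), q (P.real {ω | k < W ω}) := by
    simp only [hpq, Finset.sum_sub_distrib]
  rw [distortionRiskmetric_eq_intervalIntegral hh (neg_nonpos.2 N.cast_nonneg) N.cast_nonneg
    (hX.mono fun ω => abs_le.1), hshift, hsplit, hsum]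
  have e1 := abs_le.1 (abs_integral_sub_sum_le_of_monotoneOn hp hW (2 * N))
  have e2 := abs_le.1 (abs_integral_sub_sum_le_of_monotoneOn hq hW (2 * N))
  rw [abs_le]
  constructor <;> linarith [e1.1, e1.2, e2.1, e2.2]

/-- On integer-valued random variables the riskmetric is exactly the level sum. -/
lemma distortionRiskmetric_natCast {Ω : Type*} [MeasurableSpace Ω] {P : Measure Ω}
    [IsProbabilityMeasure P] {h : ℝ → ℝ} (hh : IsDistortion h) {W : Ω → ℕ} {N : ℕ}
    (hW : ∀ ω, W ω ≤ N) :
    distortionRiskmetric P h (fun ω => (W ω : ℝ))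
      = ∑ k ∈ Finset.range N, h (P.real {ω | k < W ω}) := by
  rw [distortionRiskmetric_eq_intervalIntegral hh le_rfl N.cast_nonneg
    (ae_of_all _ fun ω => ⟨(W ω).cast_nonneg, Nat.cast_le.2 (hW ω)⟩), zero_mul, add_zero]
  have hi := intervalIntegrable_comp_measureReal_lt (P := P) hh.1 (fun ω => (W ω : ℝ))
  have := intervalIntegral.sum_integral_adjacent_intervals (a := fun k : ℕ => (k : ℝ)) (n := N)
    fun k _ => hi (k : ℝ) ((k + 1 : ℕ) : ℝ)
  rw [Nat.cast_zero] at this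
  rw [← this]
  refine Finset.sum_congr rfl fun k _ => ?_
  have hk : (k : ℝ) ≤ ((k + 1 : ℕ) : ℝ) := by simp
  have hc : ∀ x ∈ Ico (k : ℝ) ((k + 1 : ℕ) : ℝ),
      h (P.real {ω | x < (W ω : ℝ)}) = h (P.real {ω | k < W ω}) := fun x hx => by
    have : {ω | x < (W ω : ℝ)} = {ω | k < W ω} := by
      ext ω
      constructor
      · exact fun hω => Nat.cast_lt.1 (hx.1.trans_lt hω)
      · exact fun hω => hx.2.trans_le (Nat.cast_le.2 hω)
    rw [this]
  rw [intervalIntegral.integral_of_le hk, ← integral_Ico_eq_integral_Ioc,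
    setIntegral_congr_fun measurableSet_Ico hc]
  simp

/-! ### Modular set functions and level sums -/

lemma sum_level_add_indicator {Ω : Type*} {𝓔 : Set (Set Ω)} {ν : Set Ω → ℝ}
    (hunion : ∀ E ∈ 𝓔, ∀ F ∈ 𝓔, E ∪ F ∈ 𝓔) (hinter : ∀ E ∈ 𝓔, ∀ F ∈ 𝓔, E ∩ F ∈ 𝓔)
    (hν0 : ν ∅ = 0) (hν : ∀ E ∈ 𝓔, ∀ F ∈ 𝓔, ν (E ∪ F) + ν (E ∩ F) = ν E + ν F)
    {U : Ω → ℕ} (hU : ∀ k, {ω | k < U ω} ∈ 𝓔) {m : ℕ} (hm : ∀ ω, U ω ≤ m)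
    {F : Set Ω} (hF : F ∈ 𝓔) :
    (∀ k, {ω | k < U ω + F.indicator 1 ω} ∈ 𝓔) ∧
      ∑ k ∈ Finset.range (m + 1), ν {ω | k < U ω + F.indicator 1 ω}
        = ∑ k ∈ Finset.range m, ν {ω | k < U ω} + ν F := by
  have h0 : {ω | 0 < U ω + F.indicator 1 ω} = {ω | 0 < U ω} ∪ F := by
    ext ω
    by_cases hω : ω ∈ F <;> simp [hω]
  have hs : ∀ k, {ω | k + 1 < U ω + F.indicator 1 ω}
      = {ω | k + 1 < U ω} ∪ ({ω | k < U ω} ∩ F) := by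
    intro k
    ext ω
    by_cases hω : ω ∈ F
    · simp [hω]; omega
    · simp [hω]
  have hi : ∀ k, {ω | k + 1 < U ω} ∩ ({ω | k < U ω} ∩ F) = {ω | k + 1 < U ω} ∩ F := by
    intro k
    ext ω
    simp only [mem_inter_iff, mem_ofPred_eq]
    constructor
    · exact fun hω => ⟨hω.1, hω.2.2⟩
    · exact fun hω => ⟨hω.1, by omega, hω.2⟩
  constructor
  · rintro (_ | k)
    · rw [h0]; exact hunion _ (hU 0) _ hF
    · rw [hs]; exact hunion _ (hU _) _ (hinter _ (hU _) _ hF)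
  · have e0 := hν _ (hU 0) _ hF
    have es : ∀ k, ν {ω | k + 1 < U ω + F.indicator 1 ω}
        = ν {ω | k + 1 < U ω} + (ν ({ω | k < U ω} ∩ F) - ν ({ω | k + 1 < U ω} ∩ F)) := by
      intro k
      have := hν _ (hU (k + 1)) _ (hinter _ (hU k) _ hF)
      rw [hi, ← hs] at this
      linarith
    have hmE : {ω | m < U ω} = ∅ := by
      ext ω
      simpa using hm ω
    have a1 := Finset.sum_range_succ' (fun k => ν {ω | k < U ω}) m
    have a2 := Finset.sum_range_succ (fun k => ν {ω | k < U ω}) m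
    have a3 := Finset.sum_range_sub' (fun k => ν ({ω | k < U ω} ∩ F)) m
    rw [hmE, hν0] at a2
    rw [hmE, empty_inter, hν0] at a3
    rw [Finset.sum_range_succ', Finset.sum_congr rfl fun k _ => es k, Finset.sum_add_distrib, a3,
      h0]
    linarith

/-- A set function that is modular on a lattice of events has additive level sums: the
discrete Choquet integral is additive on integer-valued functions with level sets in the
lattice. The second function is added one level set at a time. -/
lemma sum_level_add {Ω : Type*} {𝓔 : Set (Set Ω)} {ν : Set Ω → ℝ}
    (hunion : ∀ E ∈ 𝓔, ∀ F ∈ 𝓔, E ∪ F ∈ 𝓔) (hinter : ∀ E ∈ 𝓔, ∀ F ∈ 𝓔, E ∩ F ∈ 𝓔)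
    (hν0 : ν ∅ = 0)
    (hν : ∀ E ∈ 𝓔, ∀ F ∈ 𝓔, ν (E ∪ F) + ν (E ∩ F) = ν E + ν F)
    {U V : Ω → ℕ} (hU : ∀ k, {ω | k < U ω} ∈ 𝓔) (hV : ∀ k, {ω | k < V ω} ∈ 𝓔)
    {m n : ℕ} (hm : ∀ ω, U ω ≤ m) (hn : ∀ ω, V ω ≤ n) :
    ∑ k ∈ Finset.range (m + n), ν {ω | k < U ω + V ω}
      = ∑ k ∈ Finset.range m, ν {ω | k < U ω} + ∑ k ∈ Finset.range n, ν {ω | k < V ω} := by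
  suffices H : ∀ n, (∀ k, {ω | k < U ω + min (V ω) n} ∈ 𝓔) ∧
      ∑ k ∈ Finset.range (m + n), ν {ω | k < U ω + min (V ω) n}
        = ∑ k ∈ Finset.range m, ν {ω | k < U ω} + ∑ k ∈ Finset.range n, ν {ω | k < V ω} by
    have := (H n).2
    simpa only [min_eq_left (hn _)] using this
  intro n
  induction n with
  | zero => simpa using hU
  | succ n ih =>
    have hstep : ∀ ω, U ω + min (V ω) (n + 1)
        = (U ω + min (V ω) n) + {ω | n < V ω}.indicator 1 ω := by
      intro ω
      by_cases hω : n < V ω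
      · simp [hω]; omega
      · simp [hω]; omega
    have := sum_level_add_indicator hunion hinter hν0 hν ih.1
      (m := m + n) (fun ω => add_le_add (hm ω) (min_le_right _ _)) (hV n)
    simp only [hstep]
    refine ⟨this.1, ?_⟩
    rw [← add_assoc, this.2, ih.2, Finset.sum_range_succ, add_assoc]

/-! ### Events nested with a family of tail events -/

/-- The null-measurable events that are comparable, up to null sets, with every event `A p`, `p ∈ K`.
They include the level sets of the random variables having all `A p` as tail events. -/
def nestedEvents {Ω : Type*} [MeasurableSpace Ω] (P : Measure Ω) (K : Set ℝ) (A : ℝ → Set Ω) :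
    Set (Set Ω) :=
  {E | NullMeasurableSet E P ∧ ∀ p ∈ K, E ≤ᵐ[P] A p ∨ A p ≤ᵐ[P] E}

section Nested

variable {Ω : Type*} [MeasurableSpace Ω] {P : Measure Ω} {K : Set ℝ} {A : ℝ → Set Ω}

lemma union_mem_nestedEvents {E F : Set Ω} (hE : E ∈ nestedEvents P K A)
    (hF : F ∈ nestedEvents P K A) : E ∪ F ∈ nestedEvents P K A := by
  refine ⟨hE.1.union hF.1, fun p hp => ?_⟩
  rcases hE.2 p hp with h | h
  · rcases hF.2 p hp with h' | h'
    · left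
      filter_upwards [h, h'] with ω h1 h2 hω using hω.elim h1 h2
    · right
      filter_upwards [h'] with ω h1 hω using Or.inr (h1 hω)
  · right
    filter_upwards [h] with ω h1 hω using Or.inl (h1 hω)

lemma inter_mem_nestedEvents {E F : Set Ω} (hE : E ∈ nestedEvents P K A)
    (hF : F ∈ nestedEvents P K A) : E ∩ F ∈ nestedEvents P K A := by
  refine ⟨hE.1.inter hF.1, fun p hp => ?_⟩
  rcases hE.2 p hp with h | h
  · left
    filter_upwards [h] with ω h1 hω using h1 hω.1
  · rcases hF.2 p hp with h' | h'
    · left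
      filter_upwards [h'] with ω h1 hω using h1 hω.2
    · right
      filter_upwards [h, h'] with ω h1 h2 hω using ⟨h1 hω, h2 hω⟩

lemma level_mem_nestedEvents {X : Ω → ℝ} (hX : AEMeasurable X P)
    (hA : ∀ p ∈ K, IsTailEvent P X (A p)) {φ : ℝ → ℕ} (hφ : Monotone φ) (k : ℕ) :
    {ω | k < φ (X ω)} ∈ nestedEvents P K A := by
  refine ⟨(hφ.measurable.comp_aemeasurable hX).nullMeasurable measurableSet_Ioi, fun p hp => ?_⟩
  obtain ⟨-, S, hS, hT⟩ := hA p hp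
  by_cases hex : ∃ ω' ∈ S, ω' ∉ A p ∧ k < φ (X ω')
  · obtain ⟨ω', hω'S, hω'A, hk⟩ := hex
    right
    filter_upwards [hS] with ω hω hωA
    exact hk.trans_le (hφ (hT ω hω ω' hω'S hωA hω'A))
  · left
    filter_upwards [hS] with ω hω hk
    by_contra hωA
    exact hex ⟨ω, hω, hωA, hk⟩

variable [IsProbabilityMeasure P]

lemma measureReal_mono_ae {E F : Set Ω} (h : E ≤ᵐ[P] F) : P.real E ≤ P.real F :=
  ENNReal.toReal_mono (measure_ne_top _ _) (measure_mono_ae h)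

lemma ae_ge_of_ae_le_of_measureReal_le {E F : Set Ω} (hE : NullMeasurableSet E P)
    (h : E ≤ᵐ[P] F) (hFE : P.real F ≤ P.real E) : F ≤ᵐ[P] E :=
  (ae_eq_of_ae_subset_of_measure_ge h
    ((ENNReal.toReal_le_toReal (measure_ne_top _ _) (measure_ne_top _ _)).1 hFE) hE
    (measure_ne_top _ _)).symm.le

/-- If `h` is linear on the closed gaps, `h ∘ P` is modular on the nested events. Either a tail
event has probability between `P E` and `P F`, and then it separates `E` from `F`, so that the
two are nested; or `P E` and `P F` lie in one gap, whose closure then also contains `P (E ∩ F)` and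
`P (E ∪ F)`, and modularity is that of an affine function of `P`. -/
lemma distortion_modular_of_le {h : ℝ → ℝ}
    (hlin : ∀ B ∈ gaps K, IsLinearOn h (closure ((fun x => 1 - x) '' B)))
    (hAm : ∀ p ∈ K, MeasurableSet (A p)) (hA : ∀ p ∈ K, P.real (A p) = 1 - p) {E F : Set Ω}
    (hE : E ∈ nestedEvents P K A) (hF : F ∈ nestedEvents P K A) (hle : P.real E ≤ P.real F) :
    h (P.real (E ∪ F)) + h (P.real (E ∩ F)) = h (P.real E) + h (P.real F) := by
  have hui : P.real (E ∪ F) + P.real (E ∩ F) = P.real E + P.real F :=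
    measureReal_union_add_inter₀ hF.1
  by_cases hsep : ∃ p ∈ K, P.real E ≤ 1 - p ∧ 1 - p ≤ P.real F
  · obtain ⟨p, hp, hEp, hpF⟩ := hsep
    have hEA : E ≤ᵐ[P] A p := (hE.2 p hp).elim id fun h' =>
      ae_ge_of_ae_le_of_measureReal_le (hAm p hp).nullMeasurableSet h' (by rwa [hA p hp])
    have hAF : A p ≤ᵐ[P] F := (hF.2 p hp).elim
      (fun h' => ae_ge_of_ae_le_of_measureReal_le hF.1 h' (by rwa [hA p hp])) id
    have hi : P.real (E ∩ F) = P.real E := measureReal_congr (by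
      filter_upwards [hEA, hAF] with ω h1 h2
      exact propext ⟨fun hω => hω.1, fun hω => ⟨hω, h2 (h1 hω)⟩⟩)
    have hu : P.real (E ∪ F) = P.real F := by linarith
    rw [hi, hu, add_comm]
  · push Not at hsep
    have hIcc : ∀ G : Set Ω, P.real G ∈ Icc (0 : ℝ) 1 := fun G =>
      ⟨measureReal_nonneg, measureReal_le_one⟩
    set e := P.real E
    set f := P.real F
    set u := P.real (E ∩ F)
    set v := P.real (E ∪ F)
    have hue : u ≤ e := measureReal_mono inter_subset_left
    have hfv : f ≤ v := measureReal_mono subset_union_right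
    -- No tail event has a probability strictly between `u` and `v`.
    have havoid : ∀ t, u < t → t < v → 1 - t ∉ K := by
      intro t hut htv htK
      have hAt : P.real (A (1 - t)) = t := by rw [hA _ htK]; ring
      have hnot := hsep _ htK
      rw [sub_sub_cancel] at hnot
      rcases lt_or_ge t e with hte | hte
      · have h1 : A (1 - t) ≤ᵐ[P] E := (hE.2 _ htK).resolve_left fun h' => by
          have := measureReal_mono_ae h'
          rw [hAt] at this
          exact absurd hte (not_lt.2 this)
        have h2 : A (1 - t) ≤ᵐ[P] F := (hF.2 _ htK).resolve_left fun h' => by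
          have := measureReal_mono_ae h'
          rw [hAt] at this
          exact absurd (hte.trans_le hle) (not_lt.2 this)
        have : t ≤ u := hAt ▸ measureReal_mono_ae (by
          filter_upwards [h1, h2] with ω h1 h2 hω using ⟨h1 hω, h2 hω⟩)
        exact absurd hut (not_lt.2 this)
      · have hft := hnot hte
        have h1 : E ≤ᵐ[P] A (1 - t) := (hE.2 _ htK).resolve_right fun h' => by
          have := measureReal_mono_ae h'
          rw [hAt] at this
          exact absurd (hle.trans_lt hft) (not_lt.2 this)
        have h2 : F ≤ᵐ[P] A (1 - t) := (hF.2 _ htK).resolve_right fun h' => by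
          have := measureReal_mono_ae h'
          rw [hAt] at this
          exact absurd hft (not_lt.2 this)
        have : v ≤ t := hAt ▸ measureReal_mono_ae (by
          filter_upwards [h1, h2] with ω h1 h2 hω using hω.elim h1 h2)
        exact absurd htv (not_lt.2 this)
    have heK : 1 - e ∉ K := fun hK => by
      have := hsep _ hK (by simp)
      rw [sub_sub_cancel] at this
      exact absurd hle (not_le.2 this)
    have hefK : ∀ t, e ≤ t → t ≤ f → 1 - t ∉ K := fun t h1 h2 hK => by
      have := hsep _ hK (by simpa using h1)
      rw [sub_sub_cancel] at this
      exact absurd h2 (not_le.2 this)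
    set B := connectedComponentIn (Icc (0 : ℝ) 1 \ K) (1 - e) with hB
    have heI : e ∈ Icc (0 : ℝ) 1 := hIcc E
    have hmem : ∀ t ∈ Icc (0 : ℝ) 1, (∀ s ∈ uIcc e t, 1 - s ∉ K) →
        t ∈ (fun x : ℝ => 1 - x) '' B := by
      intro t ht hs
      have hpre : IsPreconnected ((fun x : ℝ => 1 - x) '' uIcc e t) :=
        isPreconnected_uIcc.image _ (by fun_prop)
      have hsub : (fun x : ℝ => 1 - x) '' uIcc e t ⊆ Icc (0 : ℝ) 1 \ K := by
        rintro _ ⟨s, hst, rfl⟩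
        have := (uIcc_subset_Icc heI ht) hst
        exact ⟨⟨by linarith [this.2], by linarith [this.1]⟩, hs s hst⟩
      exact ⟨1 - t, hpre.subset_connectedComponentIn ⟨e, left_mem_uIcc, rfl⟩ hsub
        ⟨t, right_mem_uIcc, rfl⟩, by simp⟩
    obtain ⟨m, c, hmc⟩ := hlin B ⟨1 - e, ⟨⟨by linarith [heI.2], by linarith [heI.1]⟩, heK⟩, hB⟩
    have hel : ∀ t, u < t → t ≤ e → t ∈ (fun x : ℝ => 1 - x) '' B := fun t h1 h2 =>
      hmem t ⟨(hIcc _).1.trans h1.le, h2.trans heI.2⟩ fun s hs => by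
        rw [uIcc_of_ge h2] at hs
        rcases hs.2.eq_or_lt with rfl | hse
        · exact heK
        · exact havoid s (h1.trans_le hs.1) (hse.trans_le (hle.trans hfv))
    have hfr : ∀ t, e ≤ t → t ≤ f ∨ t < v → t ≤ v → t ∈ (fun x : ℝ => 1 - x) '' B :=
      fun t h1 h2 h3 => hmem t ⟨heI.1.trans h1, h3.trans (hIcc _).2⟩ fun s hs => by
        rw [uIcc_of_le h1] at hs
        rcases le_or_gt s f with hsf | hsf
        · exact hefK s hs.1 hsf
        · have htv : t < v := h2.resolve_left (not_le.2 (hsf.trans_le hs.2))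
          exact havoid s (hue.trans_lt (hle.trans_lt hsf)) (hs.2.trans_lt htv)
    have he : e ∈ closure ((fun x : ℝ => 1 - x) '' B) :=
      subset_closure (hfr e le_rfl (Or.inl hle) (hle.trans hfv))
    have hf : f ∈ closure ((fun x : ℝ => 1 - x) '' B) :=
      subset_closure (hfr f hle (Or.inl le_rfl) hfv)
    have hu : u ∈ closure ((fun x : ℝ => 1 - x) '' B) := by
      rcases hue.eq_or_lt with hue | hue
      · rwa [hue]
      · refine closure_mono (s := Ioc u e) (fun t ht => hel t ht.1 ht.2) ?_
        rw [closure_Ioc hue.ne]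
        exact left_mem_Icc.2 hue.le
    have hv : v ∈ closure ((fun x : ℝ => 1 - x) '' B) := by
      rcases hfv.eq_or_lt with hfv | hfv
      · rwa [← hfv]
      · refine closure_mono (s := Ico f v)
          (fun t ht => hfr t (hle.trans ht.1) (Or.inr ht.2) ht.2.le) ?_
        rw [closure_Ico hfv.ne]
        exact right_mem_Icc.2 hfv.le
    rw [hmc _ he, hmc _ hf, hmc _ hu, hmc _ hv]
    linear_combination m * hui

lemma distortion_modular {h : ℝ → ℝ}
    (hlin : ∀ B ∈ gaps K, IsLinearOn h (closure ((fun x => 1 - x) '' B)))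
    (hAm : ∀ p ∈ K, MeasurableSet (A p)) (hA : ∀ p ∈ K, P.real (A p) = 1 - p) {E F : Set Ω}
    (hE : E ∈ nestedEvents P K A) (hF : F ∈ nestedEvents P K A) :
    h (P.real (E ∪ F)) + h (P.real (E ∩ F)) = h (P.real E) + h (P.real F) := by
  rcases le_total (P.real E) (P.real F) with hle | hle
  · exact distortion_modular_of_le hlin hAm hA hE hF hle
  · rw [union_comm, inter_comm, add_comm (h (P.real E))]
    exact distortion_modular_of_le hlin hAm hA hF hE hle

end Nested

/-! ### Linearity on the gaps implies additivity -/

section Additive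

variable {Ω : Type*} [MeasurableSpace Ω] {P : Measure Ω} {K : Set ℝ} {A : ℝ → Set Ω}

lemma IsTailEvent.add {X Y : Ω → ℝ} {A : Set Ω} (hX : IsTailEvent P X A)
    (hY : IsTailEvent P Y A) : IsTailEvent P (fun ω => X ω + Y ω) A := by
  obtain ⟨hA, S, hS, hSX⟩ := hX
  obtain ⟨-, T, hT, hTY⟩ := hY
  exact ⟨hA, S ∩ T, Filter.inter_mem hS hT, fun ω hω ω' hω' h1 h2 =>
    add_le_add (hSX ω hω.1 ω' hω'.1 h1 h2) (hTY ω hω.2 ω' hω'.2 h1 h2)⟩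

lemma IsTailEvent.const_mul {X : Ω → ℝ} {A : Set Ω} (hX : IsTailEvent P X A) {c : ℝ}
    (hc : 0 ≤ c) : IsTailEvent P (fun ω => c * X ω) A := by
  obtain ⟨hA, S, hS, hSX⟩ := hX
  exact ⟨hA, S, hS, fun ω hω ω' hω' h1 h2 =>
    mul_le_mul_of_nonneg_left (hSX ω hω ω' hω' h1 h2) hc⟩

lemma exists_nat_ae_abs_le {X : Ω → ℝ} (hX : MemLp X ⊤ P) : ∃ N : ℕ, ∀ᵐ ω ∂P, |X ω| ≤ N := by
  obtain ⟨N, hN⟩ := exists_nat_ge (eLpNorm X ⊤ P).toReal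
  refine ⟨N, ?_⟩
  have hfin : eLpNormEssSup X P ≠ ⊤ := by simpa using hX.2.ne
  filter_upwards [ae_le_eLpNormEssSup (f := X) (μ := P)] with ω hω
  have := ENNReal.toReal_mono hfin hω
  simp only [toReal_enorm, Real.norm_eq_abs] at this
  exact this.trans (by simpa using hN)

variable [IsProbabilityMeasure P]

/-- The additivity defect of two bounded variables with common tail events is bounded by a
constant depending on `h` only: the integer parts are additive by `sum_level_add`. -/
lemma exists_abs_distortionRiskmetric_add_sub_le {h : ℝ → ℝ} (hh : IsDistortion h)
    (hlin : ∀ B ∈ gaps K, IsLinearOn h (closure ((fun x => 1 - x) '' B))) :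
    ∃ C : ℝ, ∀ (X Y : Ω → ℝ) (A : ℝ → Set Ω), (∀ p ∈ K, P.real (A p) = 1 - p) →
      MemLp X ⊤ P → MemLp Y ⊤ P → (∀ p ∈ K, IsTailEvent P X (A p)) →
      (∀ p ∈ K, IsTailEvent P Y (A p)) →
      |distortionRiskmetric P h (fun ω => X ω + Y ω) -
        (distortionRiskmetric P h X + distortionRiskmetric P h Y)| ≤ C := by
  obtain ⟨C, hC⟩ := exists_abs_distortionRiskmetric_sub_sum_le (P := P) hh
  refine ⟨3 * C, fun X Y A hA hX hY hXA hYA => ?_⟩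
  obtain ⟨M, hM⟩ := exists_nat_ae_abs_le hX
  obtain ⟨M', hM'⟩ := exists_nat_ae_abs_le hY
  obtain ⟨N, hMN, hMN'⟩ : ∃ N : ℕ, M ≤ N ∧ M' ≤ N := ⟨max M M', le_max_left _ _, le_max_right _ _⟩
  have hXN : ∀ᵐ ω ∂P, |X ω| ≤ N := hM.mono fun ω hω => hω.trans (Nat.cast_le.2 hMN)
  have hYN : ∀ᵐ ω ∂P, |Y ω| ≤ N := hM'.mono fun ω hω => hω.trans (Nat.cast_le.2 hMN')
  -- The truncation at `2 * N` only acts on a null set.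
  let φ : ℝ → ℕ := fun x => min ⌊x + N⌋₊ (2 * N)
  have hφ : Monotone φ := fun x y hxy =>
    min_le_min_right _ (Nat.floor_mono (by linarith))
  have hφN : ∀ x, φ x ≤ 2 * N := fun x => min_le_right _ _
  have hφx : ∀ x : ℝ, |x| ≤ N → (φ x : ℝ) ≤ x + N ∧ x + N ≤ φ x + 1 := by
    intro x hx
    have hx' := abs_le.1 hx
    have hle : ⌊x + N⌋₊ ≤ 2 * N := Nat.floor_le_of_le (by push_cast; linarith)
    simp only [φ, min_eq_left hle]
    exact ⟨Nat.floor_le (by linarith), (Nat.lt_floor_add_one _).le⟩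
  have key := sum_level_add (ν := fun E => h (P.real E))
    (fun _ h1 _ h2 => union_mem_nestedEvents h1 h2)
    (fun _ h1 _ h2 => inter_mem_nestedEvents h1 h2) (by simpa using hh.2)
    (fun E hE F hF => distortion_modular hlin (fun p hp => (hXA p hp).1) hA hE hF)
    (level_mem_nestedEvents hX.1.aemeasurable hXA hφ)
    (level_mem_nestedEvents hY.1.aemeasurable hYA hφ) (fun ω => hφN _) (fun ω => hφN _)
  have eX := abs_le.1 (hC N X (fun ω => φ (X ω)) hXN (by
    filter_upwards [hXN] with ω hω
    exact ⟨(hφx _ hω).1, by linarith [(hφx _ hω).2]⟩))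
  have eY := abs_le.1 (hC N Y (fun ω => φ (Y ω)) hYN (by
    filter_upwards [hYN] with ω hω
    exact ⟨(hφx _ hω).1, by linarith [(hφx _ hω).2]⟩))
  have eS := abs_le.1 (hC (2 * N) (fun ω => X ω + Y ω) (fun ω => φ (X ω) + φ (Y ω)) (by
    filter_upwards [hXN, hYN] with ω h1 h2
    push_cast
    exact (abs_add_le _ _).trans (by linarith)) (by
    filter_upwards [hXN, hYN] with ω h1 h2
    push_cast
    have a1 := hφx _ h1
    have a2 := hφx _ h2
    exact ⟨by linarith [a1.1, a2.1], by linarith [a1.2, a2.2]⟩))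
  rw [show 2 * (2 * N) = 2 * N + 2 * N by ring, key] at eS
  push_cast at eS
  rw [abs_le]
  constructor <;> linarith [eX.1, eX.2, eY.1, eY.2, eS.1, eS.2]

/-- The defect is bounded and positively homogeneous, hence zero. -/
lemma distortionRiskmetric_add {h : ℝ → ℝ} (hh : IsDistortion h)
    (hlin : ∀ B ∈ gaps K, IsLinearOn h (closure ((fun x => 1 - x) '' B)))
    (hA : ∀ p ∈ K, P.real (A p) = 1 - p) {X Y : Ω → ℝ} (hX : MemLp X ⊤ P) (hY : MemLp Y ⊤ P)
    (hXA : ∀ p ∈ K, IsTailEvent P X (A p)) (hYA : ∀ p ∈ K, IsTailEvent P Y (A p)) :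
    distortionRiskmetric P h (fun ω => X ω + Y ω) =
      distortionRiskmetric P h X + distortionRiskmetric P h Y := by
  obtain ⟨C, hC⟩ := exists_abs_distortionRiskmetric_add_sub_le (P := P) hh hlin
  set D := distortionRiskmetric P h (fun ω => X ω + Y ω) -
    (distortionRiskmetric P h X + distortionRiskmetric P h Y) with hD
  have hn : ∀ n : ℕ, 0 < n → n * |D| ≤ C := by
    intro n hn
    have hn' : (0 : ℝ) < n := Nat.cast_pos.2 hn
    have := hC _ _ A hA (hX.const_mul (n : ℝ)) (hY.const_mul (n : ℝ))
      (fun p hp => (hXA p hp).const_mul hn'.le) (fun p hp => (hYA p hp).const_mul hn'.le)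
    simp only [← mul_add] at this
    rw [distortionRiskmetric_const_mul P h _ hn', distortionRiskmetric_const_mul P h _ hn',
      distortionRiskmetric_const_mul P h _ hn', ← mul_add, ← mul_sub, abs_mul,
      abs_of_pos hn'] at this
    exact this
  have hD0 : D = 0 := by
    by_contra hne
    have hpos : 0 < |D| := abs_pos.2 hne
    obtain ⟨n, hnC⟩ := exists_nat_gt (C / |D|)
    rw [div_lt_iff₀ hpos] at hnC
    have := hn (n + 1) n.succ_pos
    push_cast at this
    linarith
  linarith

lemma isKAdditive_of_isLinearOn {h : ℝ → ℝ} (hh : IsDistortion h)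
    (hlin : ∀ B ∈ gaps K, IsLinearOn h (closure ((fun x => 1 - x) '' B))) :
    IsKAdditive P (distortionRiskmetric P h) K := by
  intro d X hX hconc
  rcases d with _ | d
  · simpa using distortionRiskmetric_zero hh
  choose! A hA hT using hconc
  have hmain : ∀ s : Finset (Fin (d + 1)), MemLp (fun ω => ∑ i ∈ s, X i ω) ⊤ P ∧
      (∀ p ∈ K, IsTailEvent P (fun ω => ∑ i ∈ s, X i ω) (A p)) ∧
      distortionRiskmetric P h (fun ω => ∑ i ∈ s, X i ω)
        = ∑ i ∈ s, distortionRiskmetric P h (X i) := by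
    intro s
    induction s using Finset.induction_on with
    | empty =>
      simp only [Finset.sum_empty]
      exact ⟨memLp_const 0, fun p hp => ⟨(hT p hp 0).1, univ, Filter.univ_mem, by simp⟩,
        distortionRiskmetric_zero hh⟩
    | insert i s hi ih =>
      obtain ⟨h1, h2, h3⟩ := ih
      simp only [Finset.sum_insert hi]
      exact ⟨(hX i).add h1, fun p hp => (hT p hp i).add (h2 p hp), by
        rw [distortionRiskmetric_add hh hlin hA (hX i) h1 (fun p hp => hT p hp i) h2, h3]⟩
  exact (hmain Finset.univ).2.2

end Additive

/-! ### Additivity implies linearity on the gaps -/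

/-- A bounded additive function on `[0, L]` vanishing at `L` is zero: doubling modulo `L`
doubles its absolute value, so every value is at most `M / 2 ^ n` for all `n`. -/
lemma eq_zero_of_additive_of_bounded {φ : ℝ → ℝ} {L M : ℝ}
    (hadd : ∀ c d, 0 ≤ c → 0 ≤ d → c + d ≤ L → φ (c + d) = φ c + φ d)
    (hL : φ L = 0) (hM : ∀ c ∈ Icc 0 L, |φ c| ≤ M) : ∀ c ∈ Icc 0 L, φ c = 0 := by
  have hdouble : ∀ c ∈ Icc 0 L, ∃ c' ∈ Icc 0 L, |φ c'| = 2 * |φ c| := by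
    intro c hc
    rcases le_total (2 * c) L with h2 | h2
    · refine ⟨2 * c, ⟨by linarith [hc.1], h2⟩, ?_⟩
      rw [two_mul, hadd c c hc.1 hc.1 (by linarith), ← two_mul, abs_mul, abs_two]
    · refine ⟨2 * (L - c), ⟨by linarith [hc.2], by linarith⟩, ?_⟩
      have h1 := hadd c (L - c) hc.1 (by linarith [hc.2]) (by linarith)
      rw [add_sub_cancel, hL] at h1
      rw [two_mul (L - c), hadd (L - c) (L - c) (by linarith [hc.2]) (by linarith [hc.2])
        (by linarith), show φ (L - c) = -φ c by linarith, ← two_mul, abs_mul, abs_two, abs_neg]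
  have hpow : ∀ n : ℕ, ∀ c ∈ Icc 0 L, 2 ^ n * |φ c| ≤ M := by
    intro n
    induction n with
    | zero => simpa using hM
    | succ n ih =>
      intro c hc
      obtain ⟨c', hc', he⟩ := hdouble c hc
      have := ih c' hc'
      rw [he] at this
      rw [pow_succ]
      linarith
  intro c hc
  by_contra hne
  have hpos : 0 < |φ c| := abs_pos.2 hne
  obtain ⟨n, hn⟩ := pow_unbounded_of_one_lt (M / |φ c|) one_lt_two
  rw [div_lt_iff₀ hpos] at hn
  exact absurd (hpow n c hc) (not_le.2 hn)

/-- Cauchy's functional equation on a bounded interval, for bounded functions. -/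
lemma eq_mul_of_additive_of_bounded {g : ℝ → ℝ} {L M : ℝ} (hL : 0 ≤ L)
    (hadd : ∀ c d, 0 ≤ c → 0 ≤ d → c + d ≤ L → g (c + d) = g c + g d)
    (hM : ∀ c ∈ Icc 0 L, |g c| ≤ M) : ∀ c ∈ Icc 0 L, g c = g L / L * c := by
  have h0 : g 0 = 0 := by
    have := hadd 0 0 le_rfl le_rfl (by simpa using hL)
    rw [add_zero] at this
    linarith
  have key := eq_zero_of_additive_of_bounded (φ := fun c => g c - g L / L * c) (L := L)
    (M := M + |g L / L| * L)
    (fun c d hc hd hcd => by simp only [hadd c d hc hd hcd]; ring)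
    (by
      rcases hL.eq_or_lt with rfl | hL
      · simp [h0]
      · simp [hL.ne'])
    (fun c hc => by
      refine (abs_sub _ _).trans (add_le_add (hM c hc) ?_)
      rw [abs_mul, abs_of_nonneg hc.1]
      exact mul_le_mul_of_nonneg_left hc.2 (abs_nonneg _))
  exact fun c hc => sub_eq_zero.1 (key c hc)

section Necessity

variable {Ω : Type*} [MeasurableSpace Ω] {P : Measure Ω}

lemma isTailEvent_indicator_of_subset {A E : Set Ω} (hA : MeasurableSet A) (hAE : A ⊆ E) :
    IsTailEvent P (E.indicator 1) A :=
  ⟨hA, univ, Filter.univ_mem, fun ω _ ω' _ hω _ => by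
    rw [indicator_of_mem (hAE hω)]
    exact indicator_le_self' (fun _ _ => zero_le_one) ω'⟩

lemma isTailEvent_indicator_of_superset {A E : Set Ω} (hA : MeasurableSet A) (hEA : E ⊆ A) :
    IsTailEvent P (E.indicator 1) A :=
  ⟨hA, univ, Filter.univ_mem, fun ω _ ω' _ _ hω' => by
    rw [indicator_of_notMem fun h' => hω' (hEA h')]
    exact indicator_nonneg (fun _ _ => zero_le_one) ω⟩

variable [IsProbabilityMeasure P]

lemma distortionRiskmetric_indicator {h : ℝ → ℝ} (hh : IsDistortion h) (E : Set Ω) :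
    distortionRiskmetric P h (E.indicator 1) = h (P.real E) := by
  have hE : (E.indicator 1 : Ω → ℝ) = fun ω => ((E.indicator 1 ω : ℕ) : ℝ) := by
    ext ω
    by_cases hω : ω ∈ E <;> simp [hω]
  have hlev : {ω | 0 < (E.indicator 1 ω : ℕ)} = E := by
    ext ω
    by_cases hω : ω ∈ E <;> simp [hω]
  rw [hE, distortionRiskmetric_natCast hh (N := 1)
    fun ω => by by_cases hω : ω ∈ E <;> simp [hω]]
  simp [hlev]

lemma distortionRiskmetric_indicator_add {h : ℝ → ℝ} (hh : IsDistortion h) (E F : Set Ω) :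
    distortionRiskmetric P h (fun ω => E.indicator 1 ω + F.indicator 1 ω)
      = h (P.real (E ∪ F)) + h (P.real (E ∩ F)) := by
  have hEF : (fun ω => E.indicator 1 ω + F.indicator 1 ω : Ω → ℝ)
      = fun ω => ((E.indicator 1 ω + F.indicator 1 ω : ℕ) : ℝ) := by
    ext ω
    by_cases h1 : ω ∈ E <;> by_cases h2 : ω ∈ F <;> norm_num [h1, h2]
  have h0 : {ω | 0 < (E.indicator 1 ω + F.indicator 1 ω : ℕ)} = E ∪ F := by
    ext ω
    by_cases h1 : ω ∈ E <;> by_cases h2 : ω ∈ F <;> simp [h1, h2]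
  have h1 : {ω | 1 < (E.indicator 1 ω + F.indicator 1 ω : ℕ)} = E ∩ F := by
    ext ω
    by_cases h1 : ω ∈ E <;> by_cases h2 : ω ∈ F <;> simp [h1, h2]
  rw [hEF, distortionRiskmetric_natCast hh (N := 2)
    fun ω => by by_cases h1 : ω ∈ E <;> by_cases h2 : ω ∈ F <;> simp [h1, h2]]
  rw [Finset.sum_range_succ, Finset.sum_range_one, h0, h1]

/-- Additivity tested on the indicators of `A ∪ C` and `A ∪ D`, where `A`, `C`, `D` are disjoint
of probabilities `a`, `c`, `d`: these indicators are concentrated at every level outside `(a, b)`,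
so that `h (a + ·) - h a` is additive. -/
lemma IsKAdditive.distortion_add (hP : IsAtomless P) {K : Set ℝ} (hK01 : K ⊆ Icc 0 1)
    {h : ℝ → ℝ} (hh : IsDistortion h) (hadd : IsKAdditive P (distortionRiskmetric P h) K)
    {a b : ℝ} (ha : 0 ≤ a) (hb : b ≤ 1) (hab : ∀ t ∈ Ioo a b, 1 - t ∉ K) {c d : ℝ} (hc : 0 ≤ c)
    (hd : 0 ≤ d) (hcd : a + (c + d) ≤ b) :
    h (a + (c + d)) + h a = h (a + c) + h (a + d) := by
  obtain ⟨T, -, hT, hTb⟩ := hP.exists_subset_measureReal_eq MeasurableSet.univ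
    (show 0 ≤ b by linarith) (by rwa [probReal_univ])
  obtain ⟨A, hAT, hA, hAa⟩ := hP.exists_subset_measureReal_eq hT ha (by linarith)
  have hTA : P.real (T \ A) = b - a := by rw [measureReal_sdiff hAT hA, hTb, hAa]
  obtain ⟨C, hCT, hC, hCc⟩ := hP.exists_subset_measureReal_eq (hT.diff hA) hc (by linarith)
  have hTC : P.real ((T \ A) \ C) = b - a - c := by rw [measureReal_sdiff hCT hC, hTA, hCc]
  obtain ⟨D, hDT, hD, hDd⟩ := hP.exists_subset_measureReal_eq ((hT.diff hA).diff hC) hd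
    (by linarith)
  have dAC : Disjoint A C := disjoint_sdiff_right.mono_right hCT
  have dAD : Disjoint A D := disjoint_sdiff_right.mono_right (hDT.trans sdiff_subset)
  have dCD : Disjoint C D := disjoint_sdiff_right.mono_right hDT
  have hCT' : C ⊆ T := hCT.trans sdiff_subset
  have hDT' : D ⊆ T := hDT.trans (sdiff_subset.trans sdiff_subset)
  have htail : ∀ p ∈ K, ∃ S : Set Ω, P.real S = 1 - p ∧
      ∀ E : Set Ω, A ⊆ E → E ⊆ T → IsTailEvent P (E.indicator 1) S := by
    intro p hp
    have hp01 := hK01 hp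
    have hcase : 1 - p ≤ a ∨ b ≤ 1 - p := by
      by_contra! hcon
      exact hab _ hcon (by rwa [sub_sub_cancel])
    rcases hcase with hpa | hpb
    · obtain ⟨S, hSA, hS, hSp⟩ := hP.exists_subset_measureReal_eq hA
        (show 0 ≤ 1 - p by linarith [hp01.2]) (by rwa [hAa])
      exact ⟨S, hSp, fun E hAE _ => isTailEvent_indicator_of_subset hS (hSA.trans hAE)⟩
    · obtain ⟨S, hST, hS, hSp⟩ := hP.exists_subset_measureReal_eq hT.compl
        (show 0 ≤ 1 - p - b by linarith)
        (by rw [probReal_compl_eq_one_sub hT, hTb]; linarith [hp01.1])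
      refine ⟨T ∪ S, ?_, fun E _ hET =>
        isTailEvent_indicator_of_superset (hT.union hS) (hET.trans subset_union_left)⟩
      rw [measureReal_union (disjoint_compl_right.mono_right hST) hS, hTb, hSp]
      ring
  let X : Fin 2 → Ω → ℝ := ![(A ∪ C).indicator 1, (A ∪ D).indicator 1]
  have hX := hadd 2 X
    (fun i => by
      fin_cases i
      · exact (memLp_const (1 : ℝ)).indicator (hA.union hC)
      · exact (memLp_const (1 : ℝ)).indicator (hA.union hD))
    (fun p hp => by
      obtain ⟨S, hSp, hS⟩ := htail p hp
      refine ⟨S, hSp, fun i => ?_⟩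
      fin_cases i
      · exact hS _ subset_union_left (union_subset hAT hCT')
      · exact hS _ subset_union_left (union_subset hAT hDT'))
  simp only [Fin.sum_univ_two, X, Matrix.cons_val_zero, Matrix.cons_val_one] at hX
  have hinter : (A ∪ C) ∩ (A ∪ D) = A := by
    rw [← union_inter_distrib_left, dCD.inter_eq, union_empty]
  have hunion : (A ∪ C) ∪ (A ∪ D) = A ∪ (C ∪ D) := (union_union_distrib_left A C D).symm
  rw [distortionRiskmetric_indicator_add hh, distortionRiskmetric_indicator hh,
    distortionRiskmetric_indicator hh, hinter, hunion,
    measureReal_union (disjoint_union_right.2 ⟨dAC, dAD⟩) (hC.union hD),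
    measureReal_union dCD hD, measureReal_union dAC hC, measureReal_union dAD hD,
    hAa, hCc, hDd] at hX
  exact hX

lemma IsKAdditive.isLinearOn (hP : IsAtomless P) {K : Set ℝ} (hK01 : K ⊆ Icc 0 1)
    {h : ℝ → ℝ} (hh : IsDistortion h) (hadd : IsKAdditive P (distortionRiskmetric P h) K)
    {B : Set ℝ} (hB : B ∈ gaps K) : IsLinearOn h (closure ((fun x => 1 - x) '' B)) := by
  obtain ⟨x, hx, rfl⟩ := hB
  set S := (fun x : ℝ => 1 - x) '' connectedComponentIn (Icc (0 : ℝ) 1 \ K) x with hS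
  have hSsub : ∀ t ∈ S, t ∈ Icc (0 : ℝ) 1 ∧ 1 - t ∉ K := by
    rintro _ ⟨y, hy, rfl⟩
    have := connectedComponentIn_subset _ _ hy
    exact ⟨⟨by linarith [this.1.2], by linarith [this.1.1]⟩, by simpa using this.2⟩
  have hSne : S.Nonempty := ⟨1 - x, x, mem_connectedComponentIn hx, rfl⟩
  have hSconn : IsConnected S :=
    ⟨hSne, isPreconnected_connectedComponentIn.image _ (by fun_prop)⟩
  have hbelow : BddBelow S := ⟨0, fun t ht => (hSsub t ht).1.1⟩
  have habove : BddAbove S := ⟨1, fun t ht => (hSsub t ht).1.2⟩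
  set a := sInf S
  set b := sSup S
  have ha : 0 ≤ a := le_csInf hSne fun t ht => (hSsub t ht).1.1
  have hb : b ≤ 1 := csSup_le hSne fun t ht => (hSsub t ht).1.2
  have hle : a ≤ b := csInf_le_csSup hSne hbelow habove
  have hclosure : closure S ⊆ Icc a b :=
    closure_minimal (fun t ht => ⟨csInf_le hbelow ht, le_csSup habove ht⟩) isClosed_Icc
  have hab : ∀ t ∈ Ioo a b, 1 - t ∉ K := fun t ht =>
    (hSsub t (hSconn.Ioo_csInf_csSup_subset hbelow habove ht)).2
  obtain ⟨p, q, hp, hq, hpq⟩ := hh.1.exists_monotoneOn_Icc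
  have key := eq_mul_of_additive_of_bounded (g := fun c => h (a + c) - h a) (L := b - a)
    (M := (p 1 - p 0) + (q 1 - q 0)) (by linarith)
    (fun c d hc hd hcd => by
      have := hadd.distortion_add hP hK01 hh ha hb hab hc hd (by linarith)
      rw [← add_assoc] at this ⊢
      linarith)
    (fun c hc => by
      have m1 : a + c ∈ Icc (0 : ℝ) 1 := ⟨by linarith [hc.1], by linarith [hc.2]⟩
      have m2 : a ∈ Icc (0 : ℝ) 1 := ⟨ha, by linarith⟩
      have z : (0 : ℝ) ∈ Icc (0 : ℝ) 1 := by simp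
      have o : (1 : ℝ) ∈ Icc (0 : ℝ) 1 := by simp
      have le : a ≤ a + c := by linarith [hc.1]
      have p1 := hp m2 m1 le
      have q1 := hq m2 m1 le
      have p2 := hp m1 o m1.2
      have q2 := hq m1 o m1.2
      have p3 := hp z m2 ha
      have q3 := hq z m2 ha
      simp only [hpq]
      rw [abs_le]
      constructor <;> linarith)
  refine ⟨(h (a + (b - a)) - h a) / (b - a), h a - (h (a + (b - a)) - h a) / (b - a) * a,
    fun t ht => ?_⟩
  have ht' := hclosure ht
  have := key (t - a) ⟨by linarith [ht'.1], by linarith [ht'.2]⟩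
  simp only [add_sub_cancel] at this ⊢
  linear_combination this

end Necessity

theorem mainTheorem1 {Ω : Type*} [MeasurableSpace Ω] (P : Measure Ω) [IsProbabilityMeasure P]
    (hP : IsAtomless P) (K : Set ℝ) (hK : IsClosed K) (hK01 : K ⊆ Icc 0 1)
    (h : ℝ → ℝ) (hh : IsDistortion h) :
    IsKAdditive P (distortionRiskmetric P h) K ↔
      ∀ B ∈ gaps K, IsLinearOn h (closure ((fun x => 1 - x) '' B)) :=
  ⟨fun hadd _ hB => hadd.isLinearOn hP hK01 hh hB, isKAdditive_of_isLinearOn hh⟩
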